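/- Let $\mathcal X=\{x\in\mathbb R^k:\|x\|\le \tfrac12\}$ with the Euclidean distance $d$ and the uniform distribution $\mathcal U[\mathcal X]$, and let $\mathcal C_{\mathrm{HHS}}$ be the class of homogeneous half-spaces $x\mapsto \mathbb 1\{\langle\omega,x\rangle\ge 0\}$ on $\mathcal X$, $\omega\in\mathbb R^k$. For a target $\ell\in\mathcal C_{\mathrm{HHS}}$ and $x\in\mathcal X$ let $\mathrm{CE}_{\min}(x)$ be the set of points closest to $x$ among the points of $\mathcal X$ that are limits of sequences in $\mathcal X$ with labels different from $\ell(x)$. For $f:\mathbb R^{\ge0}\to\mathbb R^{\ge0}$, the deterministic approximate minimum distance mechanism allows the oracle to pair $x$ with any point of $$\mathrm{CE}^{f}_{\mathrm{app}}(x)=\{x'\in\mathcal X : \ell(x')\neq \ell(x),\ d(x',p)\le f(d(x,p))\text{ for some }p\in \mathrm{CE}_{\min}(x)\}$$ (and with any point of $\mathcal X$ if this set is empty). A passive learner for a target $\ell$ receives the set of pairs $((x_i,\ell(x_i)),(x_i',\ell(x_i')))$, $1\le i\le m$, where the $x_i$ are i.i.d. from $\mathcal U[\mathcal X]$ and the $x'_i$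 are chosen adversarially as the mechanism allows, and outputs a hypothesis $C\in \mathcal C_{\mathrm{HHS}}$, with error $\mathrm{err}(C,\ell)=\Pr_{x\sim\mathcal U[\mathcal X]}[C(x)\ne\ell(x)]$. Its sample complexity at $(\varepsilon,\delta)\in(0,1]^2$ is the least $m^*\in\mathbb N$ such that $\Pr[\mathrm{err}(C,\ell)>\varepsilon]<\delta$ for all $\ell\in\mathcal C_{\mathrm{HHS}}$ and all $m\ge m^*$; the passive contrastive sample complexity $\mathcal M(\varepsilon,\delta)$ of $\mathcal C_{\mathrm{HHS}}$ is the infimum of this number over all passive learners. Theorem. There is an absolute constant $K>0$ such that the following holds for every dimension $k$. Let $f:\mathbb R^{\ge0}\to\mathbb R^{\ge0}$ satisfy $f(x)\le x^2$ for all $x$, and let $g(x)=f(x)/x$ (with $g(0)=0$) be non-decreasing and invertible (onto its range). Then for all $\varepsilon,\delta\in(0,1]$ with $\pi\varepsilon$ in the range of $g$, $$\mathcal M(\varepsilon,\delta)\le \max\Bigl\{1,\ K\,\frac{\log(1/\delta)}{g^{-1}(\pi\varepsilon)}\Bigr\}.$$ The same bound holds for the sample complexity of every learner that, on each non-empty sample,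 selects a pair $(x_i,x_i')$ minimizing $d(x_i,x'_i)$ and outputs the homogeneous half-space perpendicular to $x_i-x'_i$ with normal vector pointing from the negative to the positive point (or the constant-one concept, $\omega=0$, if the two labels agree). -/

import Mathlib

open MeasureTheory Set Filter Topology
open scoped NNReal ENNReal

noncomputable section

namespace Contrastive

/-- A labelled example `(x, ℓ(x))`; a concept is identified with its set of positive points. -/
abbrev Example (E : Type*) : Type _ := E × Prop

/-- A labelled primary example together with its labelled contrastive example. -/
abbrev ExamplePair (E : Type*) : Type _ := Example E × Example E

/-- The pair of labelled examples consisting of the primary point `x` and the contrastive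
point `y`, both labelled by the target concept `ℓ`. -/
def labelledPair {E : Type*} (ℓ : Set E) (x y : E) : ExamplePair E :=
  ((x, x ∈ ℓ), (y, y ∈ ℓ))

section Metric

variable {E : Type*} [MetricSpace E]

/-- Points of `X` that are limits of Cauchy sequences of points of `X` whose label differs
from the label of `x`. -/
def oppositeLimits (X ℓ : Set E) (x : E) : Set E :=
  {y | y ∈ X ∧ ∃ u : ℕ → E,
    (∀ n, u n ∈ X ∧ ¬ (u n ∈ ℓ ↔ x ∈ ℓ)) ∧ CauchySeq u ∧ Tendsto u atTop (𝓝 y)}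

/-- The minimum distance mechanism: the closest points to `x` in `oppositeLimits`. -/
def minDistCE (X ℓ : Set E) (x : E) : Set E :=
  {y | y ∈ oppositeLimits X ℓ x ∧ ∀ z ∈ oppositeLimits X ℓ x, dist x y ≤ dist x z}

/-- The deterministic approximate minimum distance mechanism (deterministic AMDM) with noise
function `f`. -/
def approxCE (X : Set E) (f : ℝ≥0 → ℝ≥0) (ℓ : Set E) (x : E) : Set E :=
  {y | y ∈ X ∧ (∃ p ∈ minDistCE X ℓ x, nndist y p ≤ f (nndist x p)) ∧ ¬ (y ∈ ℓ ↔ x ∈ ℓ)}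

end Metric

/-- The points with which an oracle following the mechanism `CE` may answer the primary example
`x` when the target is `ℓ`. If `CE` admits no contrastive example for `x`, nothing is promised
about the answer: it is an arbitrary point of `X`. -/
def oracleAnswers {E : Type*} (X : Set E) (CE : Set E → E → Set E) (ℓ : Set E) (x : E) : Set E :=
  {y | y ∈ X ∧ ((CE ℓ x).Nonempty → y ∈ CE ℓ x)}

/-- A (deterministic) passive learner for the concept class `𝒞`: it maps the unordered set of
observed pairs of labelled examples to a hypothesis from `𝒞`. -/
structure PassiveLearner {E : Type*} (𝒞 : Set (Set E)) where
  /-- the hypothesis that is output on a set of pairs -/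
  hyp : Set (ExamplePair E) → Set E
  /-- hypotheses belong to the concept class -/
  hyp_mem : ∀ S, hyp S ∈ 𝒞

section Complexity

variable {E : Type*} [MeasureSpace E]

/-- The uniform distribution on `X`. -/
def uniform (X : Set E) : Measure E := ProbabilityTheory.cond volume X

/-- The error of the hypothesis `C` with respect to the target `ℓ`. -/
def err (X C ℓ : Set E) : ℝ := (uniform X).real {x | ¬ (x ∈ ℓ ↔ x ∈ C)}

/-- The samples of `m` primary examples for which some choice of oracle answers makes the learner
output a hypothesis with error larger than `ε`. The answers are chosen adversarially, and may
depend on the whole sample. -/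
def failureSet (X : Set E) {𝒞 : Set (Set E)} (CE : Set E → E → Set E) (A : PassiveLearner 𝒞)
    (ℓ : Set E) (m : ℕ) (ε : ℝ) : Set (Fin m → E) :=
  {x | ∃ y : Fin m → E, (∀ i, y i ∈ oracleAnswers X CE ℓ (x i)) ∧
    ε < err X (A.hyp (range fun i => labelledPair ℓ (x i) (y i))) ℓ}

/-- `n` samples, and any larger number of them, suffice for `A`: for every target in the class, the
probability over i.i.d. uniform primary examples that the error exceeds `ε` is less than `δ`. -/
def Suffices (X : Set E) {𝒞 : Set (Set E)} (CE : Set E → E → Set E) (A : PassiveLearner 𝒞)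
    (ε δ : ℝ) (n : ℕ) : Prop :=
  ∀ ℓ ∈ 𝒞, ∀ m : ℕ, n ≤ m →
    Measure.pi (fun _ : Fin m => uniform X) (failureSet X CE A ℓ m ε) < ENNReal.ofReal δ

/-- The contrastive sample complexity of the passive learner `A` (it is `⊤` if no number of
samples suffices). -/
def learnerSampleComplexity (X : Set E) {𝒞 : Set (Set E)} (CE : Set E → E → Set E)
    (A : PassiveLearner 𝒞) (ε δ : ℝ) : ℕ∞ :=
  ⨅ (n : ℕ) (_ : Suffices X CE A ε δ n), (n : ℕ∞)

/-- The passive contrastive sample complexity of the concept class `𝒞` over `X`. -/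
def passiveSampleComplexity (X : Set E) (𝒞 : Set (Set E)) (CE : Set E → E → Set E)
    (ε δ : ℝ) : ℕ∞ :=
  ⨅ A : PassiveLearner 𝒞, learnerSampleComplexity X CE A ε δ

end Complexity

/-- The domain: the closed Euclidean ball of radius `1/2` in `ℝᵏ`. -/
def halfBall (k : ℕ) : Set (EuclideanSpace ℝ (Fin k)) := Metric.closedBall 0 (1 / 2)

/-- The homogeneous half-space `𝟙{⟨ω, x⟩ ≥ 0}` over the ball. -/
def halfSpace {k : ℕ} (ω : EuclideanSpace ℝ (Fin k)) : Set (EuclideanSpace ℝ (Fin k)) :=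
  {x | x ∈ halfBall k ∧ 0 ≤ inner ℝ ω x}

/-- The class of homogeneous half-spaces. -/
def HHS (k : ℕ) : Set (Set (EuclideanSpace ℝ (Fin k))) := range halfSpace

open Classical in
/-- The homogeneous half-space perpendicular to the segment between the two points of a pair with
distinct labels, oriented towards the positive point (if the labels agree: the constant-one
concept, whose normal vector is zero). -/
def pairHalfSpace {k : ℕ} (p : ExamplePair (EuclideanSpace ℝ (Fin k))) :
    Set (EuclideanSpace ℝ (Fin k)) :=
  if p.1.2 ∧ ¬ p.2.2 then halfSpace (p.1.1 - p.2.1)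
  else if ¬ p.1.2 ∧ p.2.2 then halfSpace (p.2.1 - p.1.1)
  else halfSpace 0

/-- On each non-empty sample, the learner uses a pair whose contrastive example is closest to its
primary example (ties are broken arbitrarily). -/
def UsesClosestPair {k : ℕ} (A : PassiveLearner (HHS k)) : Prop :=
  ∀ S : Set (ExamplePair (EuclideanSpace ℝ (Fin k))), S.Finite → S.Nonempty →
    ∃ p ∈ S, (∀ q ∈ S, dist p.1.1 p.2.1 ≤ dist q.1.1 q.2.1) ∧ A.hyp S = pairHalfSpace p

end Contrastive

end

namespace Contrastive

variable {k : ℕ}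

/-! Let `ω` be the unit normal of the target and `t = |⟨ω, x⟩|`. For almost every `x` the unique
nearest boundary point is the foot of the perpendicular, so an answer `y` lies across the hyperplane
within `f t` of that foot. Hence `x - y` has normal component at least `t` and tangential component
at most `f t`, and its angle to `±ω` is at most `f t / t`. Half-spaces at angle `θ` disagree with
probability at most `θ / π` (`uniform_wedge_le`), so one pair gives error at most `g t / π`
(`err_pairHalfSpace_le`).

The learner does not see `t`, but `t ≤ dist x y ≤ 3/2 * t`. If some primary point has `t ≤ 2/3 * r`
with `g r = π ε`, the closest pair therefore has `t ≤ r` and error at most `ε`. A sample point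
misses this slab with probability at most `1 - 4/3 * r` in every dimension
(`uniform_slab_compl_le`), and independence gives `(1 - 4/3 * r) ^ m`. -/

/-! ### The uniform distribution on the ball: symmetry and central slabs -/

theorem volume_halfBall_ne_zero (k : ℕ) : volume (halfBall k) ≠ 0 :=
  (Metric.measure_closedBall_pos volume _ (by norm_num)).ne'

theorem volume_halfBall_ne_top (k : ℕ) : volume (halfBall k) ≠ ∞ :=
  measure_closedBall_lt_top.ne

theorem measurableSet_halfBall (k : ℕ) : MeasurableSet (halfBall k) :=
  Metric.isClosed_closedBall.measurableSet

theorem mem_halfBall {x : EuclideanSpace ℝ (Fin k)} : x ∈ halfBall k ↔ ‖x‖ ≤ 1 / 2 := by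
  simp [halfBall]

instance isProbabilityMeasure_uniform_halfBall (k : ℕ) :
    IsProbabilityMeasure (uniform (halfBall k)) :=
  ProbabilityTheory.cond_isProbabilityMeasure_of_finite (volume_halfBall_ne_zero k)
    (volume_halfBall_ne_top k)

theorem ae_uniform_mem_halfBall (k : ℕ) : ∀ᵐ x ∂uniform (halfBall k), x ∈ halfBall k :=
  ProbabilityTheory.ae_cond_mem (measurableSet_halfBall k)

/-- The uniform distribution on the ball is invariant under linear isometries. -/
theorem uniform_halfBall_preimage (R : EuclideanSpace ℝ (Fin k) ≃ₗᵢ[ℝ] EuclideanSpace ℝ (Fin k))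
    (A : Set (EuclideanSpace ℝ (Fin k))) :
    uniform (halfBall k) (R ⁻¹' A) = uniform (halfBall k) A := by
  have h : halfBall k ∩ R ⁻¹' A = R ⁻¹' (halfBall k ∩ A) := by
    ext x; simp [mem_halfBall]
  rw [uniform, ProbabilityTheory.cond_apply (measurableSet_halfBall k),
    ProbabilityTheory.cond_apply (measurableSet_halfBall k), h]
  congr 1
  exact R.measurePreserving.measure_preimage_equiv (f := R.toMeasurableEquiv) _

/-- Hyperplanes are null sets for the uniform distribution on the ball. -/
theorem ae_uniform_inner_ne_zero {ω : EuclideanSpace ℝ (Fin k)} (hω : ω ≠ 0) :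
    ∀ᵐ x ∂uniform (halfBall k), (inner ℝ ω x : ℝ) ≠ 0 := by
  suffices h : ∀ᵐ x ∂(volume : Measure (EuclideanSpace ℝ (Fin k))), (inner ℝ ω x : ℝ) ≠ 0 from
    ProbabilityTheory.cond_absolutelyContinuous.ae_le h
  rw [ae_iff]
  have h := Measure.addHaar_submodule (volume : Measure (EuclideanSpace ℝ (Fin k)))
    (LinearMap.ker (innerₛₗ ℝ ω)) (fun h => hω (by
      have : ω ∈ LinearMap.ker (innerₛₗ ℝ ω) := h ▸ Submodule.mem_top
      simpa using this))
  convert h using 2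
  ext x; simp

/-- The part of the ball far away from a central hyperplane has small measure. -/
theorem uniform_slab_compl_le {ω : EuclideanSpace ℝ (Fin k)} (hω : ‖ω‖ = 1) {s : ℝ} (hs : 0 ≤ s) :
    uniform (halfBall k) {x | s < |inner ℝ ω x|} ≤ ENNReal.ofReal (1 - 2 * s) := by
  have hball : ∀ x ∈ halfBall k, |(inner ℝ ω x : ℝ)| ≤ 1 / 2 := fun x hx => by
    have := abs_real_inner_le_norm ω x
    rw [hω] at this
    linarith [mem_halfBall.1 hx]
  rcases le_total 1 (2 * s) with h1 | h1
  · have h0 : uniform (halfBall k) {x | s < |inner ℝ ω x|} = 0 := by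
      refine measure_mono_null (t := {x | ¬ x ∈ halfBall k}) (fun x hx hxb => ?_)
        (ae_iff.1 (ae_uniform_mem_halfBall k))
      have := hball x hxb
      have hx' : s < |(inner ℝ ω x : ℝ)| := hx
      linarith
    rw [h0]
    exact zero_le
  · have hmeas : MeasurableSet {x : EuclideanSpace ℝ (Fin k) | |inner ℝ ω x| ≤ s} :=
      (isClosed_le (by fun_prop) continuous_const).measurableSet
    have hc : {x : EuclideanSpace ℝ (Fin k) | s < |inner ℝ ω x|} =
        {x | |inner ℝ ω x| ≤ s}ᶜ := by ext; simp
    rw [hc, prob_compl_eq_one_sub hmeas, ENNReal.ofReal_sub _ (by positivity), ENNReal.ofReal_one]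
    refine tsub_le_tsub_left ?_ _
    have hωω : (inner ℝ ω ω : ℝ) = 1 := by simp [hω]
    -- Scaling by `2 * s` along `ω`, identity on its orthogonal complement: this squeezes the ball
    -- into its own slab and multiplies volume by `2 * s`, whatever the dimension.
    set T : EuclideanSpace ℝ (Fin k) →ₗ[ℝ] EuclideanSpace ℝ (Fin k) :=
      LinearMap.transvection (innerₛₗ ℝ ω) ((2 * s - 1) • ω) with hT
    have hTx : ∀ x, T x = x + (inner ℝ ω x : ℝ) • ((2 * s - 1) • ω) := fun x => by
      simp [hT, LinearMap.transvection.apply]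
    have hdet : T.det = 2 * s := by
      rw [hT, LinearMap.transvection.det]
      simp [hω]
    have hin : ∀ x, (inner ℝ ω (T x) : ℝ) = 2 * s * inner ℝ ω x := fun x => by
      rw [hTx, inner_add_right, inner_smul_right, inner_smul_right, hωω]; ring
    have hsub : T '' halfBall k ⊆ halfBall k ∩ {x | |inner ℝ ω x| ≤ s} := by
      rintro _ ⟨x, hx, rfl⟩
      have hi := hball x hx
      rw [mem_halfBall] at hx
      constructor
      · rw [mem_halfBall]
        refine le_trans ?_ hx
        refine le_of_sq_le_sq ?_ (norm_nonneg _)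
        rw [← real_inner_self_eq_norm_sq, ← real_inner_self_eq_norm_sq]
        nth_rw 2 [hTx]
        rw [inner_add_right, inner_smul_right, inner_smul_right, real_inner_comm ω (T x), hin,
          real_inner_comm, hTx, inner_add_right, inner_smul_right, inner_smul_right,
          real_inner_comm ω x]
        nlinarith [mul_nonneg (sq_nonneg (inner ℝ ω x : ℝ)) (by nlinarith : 0 ≤ 1 - (2 * s) ^ 2)]
      · simp only [mem_ofPred_eq, hin, abs_mul, abs_of_nonneg (by positivity : 0 ≤ 2 * s)]
        nlinarith
    rw [uniform, ProbabilityTheory.cond_apply (measurableSet_halfBall k)]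
    have h2 : ENNReal.ofReal (2 * s) * volume (halfBall k) ≤
        volume (halfBall k ∩ {x | |inner ℝ ω x| ≤ s}) := by
      refine le_trans ?_ (measure_mono hsub)
      rw [Measure.addHaar_image_linearMap, hdet, abs_of_nonneg (by positivity)]
    calc ENNReal.ofReal (2 * s)
        = (volume (halfBall k))⁻¹ * (ENNReal.ofReal (2 * s) * volume (halfBall k)) := by
          rw [mul_left_comm, ENNReal.inv_mul_cancel (volume_halfBall_ne_zero k)
            (volume_halfBall_ne_top k), mul_one]
      _ ≤ _ := by gcongr

/-! ### Measure of a wedge between two central hyperplanes -/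

theorem zero_le_sin_pi_mul_iff {y : ℝ} (hy : Real.sin (Real.pi * y) ≠ 0) :
    0 ≤ Real.sin (Real.pi * y) ↔ Even ⌊y⌋ := by
  have h : Real.sin (Real.pi * y) = (-1) ^ ⌊y⌋ * Real.sin (Real.pi * Int.fract y) := by
    rw [← Real.sin_add_int_mul_pi]
    congr 1
    nth_rw 1 [← Int.fract_add_floor y]
    ring
  have h0 : 0 ≤ Real.sin (Real.pi * Int.fract y) :=
    Real.sin_nonneg_of_nonneg_of_le_pi (mul_nonneg Real.pi_pos.le (Int.fract_nonneg y))
      (mul_le_of_le_one_right Real.pi_pos.le (Int.fract_lt_one y).le)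
  rcases Int.even_or_odd ⌊y⌋ with he | ho
  · rw [h, he.neg_one_zpow, one_mul]
    exact ⟨fun _ => he, fun _ => h0⟩
  · rw [h, ho.neg_one_zpow] at hy ⊢
    have h1 : Real.sin (Real.pi * Int.fract y) ≠ 0 := fun h => hy (by simp [h])
    have := lt_of_le_of_ne h0 h1.symm
    exact ⟨fun h => by linarith, fun h => absurd h (Int.not_even_iff_odd.2 ho)⟩

open Classical in
/-- A sinusoid sampled at `N` consecutive steps of length `θ` has at most `N θ / π + 1` sign
changes. -/
theorem sum_sign_changes_le (a b : ℝ) {θ : ℝ} (hθ : 0 ≤ θ) (N : ℕ)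
    (h0 : ∀ i : ℕ, a * Real.cos (i * θ) + b * Real.sin (i * θ) ≠ 0) :
    ∑ i ∈ Finset.range N,
      (if ¬ (0 ≤ a * Real.cos (i * θ) + b * Real.sin (i * θ) ↔
        0 ≤ a * Real.cos ((i + 1 : ℕ) * θ) + b * Real.sin ((i + 1 : ℕ) * θ)) then (1 : ℝ) else 0)
      ≤ N * (θ / Real.pi) + 1 := by
  set z : ℂ := ⟨a, b⟩ with hz
  have hz0 : z ≠ 0 := by
    intro h
    have ha : a = 0 := congrArg Complex.re h
    have hb : b = 0 := congrArg Complex.im h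
    exact h0 0 (by simp [ha, hb])
  have hρ : 0 < ‖z‖ := norm_pos_iff.2 hz0
  have hπ := Real.pi_pos
  have ha : a = ‖z‖ * Real.cos z.arg := (Complex.norm_mul_cos_arg z).symm
  have hb : b = ‖z‖ * Real.sin z.arg := (Complex.norm_mul_sin_arg z).symm
  -- The phase in units of `π`; the shift by `1 / 2` turns the cosine into a sine, so the sign is
  -- the parity of `⌊y i⌋`. Each sign change then raises the floor by at least one, and the
  -- increments telescope.
  let y : ℕ → ℝ := fun i => (i * θ - z.arg) / Real.pi + 1 / 2
  have hy : ∀ i : ℕ, a * Real.cos (i * θ) + b * Real.sin (i * θ) =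
      ‖z‖ * Real.sin (Real.pi * y i) := fun i => by
    have : Real.pi * y i = (i * θ - z.arg) + Real.pi / 2 := by
      simp only [y]; field_simp
    rw [this, Real.sin_add_pi_div_two, Real.cos_sub]
    nth_rw 1 [ha, hb]
    ring
  have hsign : ∀ i : ℕ, (0 ≤ a * Real.cos (i * θ) + b * Real.sin (i * θ) ↔ Even ⌊y i⌋) := by
    intro i
    have h1 : Real.sin (Real.pi * y i) ≠ 0 := fun h => h0 i (by rw [hy, h, mul_zero])
    rw [hy, mul_nonneg_iff_of_pos_left hρ, zero_le_sin_pi_mul_iff h1]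
  have hmono : ∀ i : ℕ, ⌊y i⌋ ≤ ⌊y (i + 1)⌋ := fun i => by
    apply Int.floor_mono
    simp only [y]
    push_cast
    gcongr
    nlinarith
  calc _ ≤ ∑ i ∈ Finset.range N, ((⌊y (i + 1)⌋ : ℝ) - ⌊y i⌋) := by
        refine Finset.sum_le_sum fun i _ => ?_
        have hle : (⌊y i⌋ : ℝ) ≤ ⌊y (i + 1)⌋ := by exact_mod_cast hmono i
        split_ifs with h
        · linarith
        · rw [hsign i, hsign (i + 1)] at h
          have hne : ⌊y i⌋ ≠ ⌊y (i + 1)⌋ := fun h' => h (by rw [h'])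
          have : ⌊y i⌋ + 1 ≤ ⌊y (i + 1)⌋ := lt_of_le_of_ne (hmono i) hne
          have : (⌊y i⌋ : ℝ) + 1 ≤ ⌊y (i + 1)⌋ := by exact_mod_cast this
          linarith
    _ = ⌊y N⌋ - ⌊y 0⌋ := Finset.sum_range_sub (fun i => (⌊y i⌋ : ℝ)) N
    _ ≤ y N - (y 0 - 1) := sub_le_sub (Int.floor_le _) (Int.sub_one_lt_floor _).le
    _ = _ := by simp only [y]; push_cast; ring

/-- Two central half-spaces whose normal vectors enclose the angle `θ` differ on a set of uniform
measure at most `θ / π`. -/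
theorem uniform_wedge_le {u v : EuclideanSpace ℝ (Fin k)} (hu : ‖u‖ = 1) (hv : ‖v‖ = 1)
    (huv : (inner ℝ u v : ℝ) = 0) {θ : ℝ} (hθ : 0 ≤ θ) :
    (uniform (halfBall k)).real {x | ¬ (0 ≤ (inner ℝ u x : ℝ) ↔
      0 ≤ (inner ℝ (Real.cos θ • u + Real.sin θ • v) x : ℝ))} ≤ θ / Real.pi := by
  classical
  set μ := uniform (halfBall k) with hμ
  let n : ℕ → EuclideanSpace ℝ (Fin k) := fun i => Real.cos (i * θ) • u + Real.sin (i * θ) • v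
  let D : ℕ → Set (EuclideanSpace ℝ (Fin k)) := fun i =>
    {x | ¬ (0 ≤ (inner ℝ (n i) x : ℝ) ↔ 0 ≤ (inner ℝ (n (i + 1)) x : ℝ))}
  have huu : (inner ℝ u u : ℝ) = 1 := by simp [hu]
  have hvv : (inner ℝ v v : ℝ) = 1 := by simp [hv]
  have hvu : (inner ℝ v u : ℝ) = 0 := by rw [real_inner_comm]; exact huv
  have hninner : ∀ i j : ℕ, (inner ℝ (n i) (n j) : ℝ) = Real.cos (i * θ - j * θ) := fun i j => by
    simp only [n, inner_add_left, inner_add_right, inner_smul_left, inner_smul_right, huu, hvv,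
      huv, hvu, Real.cos_sub]
    simp [mul_comm]
  have hnnorm : ∀ i, ‖n i‖ = 1 := fun i => by
    rw [norm_eq_sqrt_real_inner, hninner]; simp
  -- Reflection in the line of the middle normal swaps its two neighbours, so it carries each wedge
  -- to the next and all wedges `D i` have equal measure.
  have hrefl : ∀ i, (ℝ ∙ n (i + 1)).reflection (n i) = n (i + 2) := fun i => by
    rw [Submodule.reflection_singleton_apply, hnnorm, hninner]
    have e0 : ((i + 1 : ℕ) : ℝ) * θ - i * θ = θ := by push_cast; ring
    have e1 : (i : ℝ) * θ = (i + 1 : ℕ) * θ - θ := by push_cast; ring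
    have e2 : ((i + 2 : ℕ) : ℝ) * θ = (i + 1 : ℕ) * θ + θ := by push_cast; ring
    simp only [n, e0]
    rw [e1, e2, Real.cos_sub, Real.cos_add, Real.sin_sub, Real.sin_add]
    simp only [RCLike.ofReal_real_eq_id, id_eq]
    module
  have hstep : ∀ i, μ (D (i + 1)) = μ (D i) := fun i => by
    rw [← uniform_halfBall_preimage (ℝ ∙ n (i + 1)).reflection (D i)]
    congr 1
    ext x
    have h1 : (inner ℝ (n i) ((ℝ ∙ n (i + 1)).reflection x) : ℝ) = inner ℝ (n (i + 2)) x := by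
      rw [← hrefl, ← Submodule.reflection_reflection (ℝ ∙ n (i + 1)) (n i),
        LinearIsometryEquiv.inner_map_map, Submodule.reflection_reflection]
    have h2 : (inner ℝ (n (i + 1)) ((ℝ ∙ n (i + 1)).reflection x) : ℝ) =
        inner ℝ (n (i + 1)) x := by
      nth_rw 1 [← Submodule.reflection_mem_subspace_eq_self (K := ℝ ∙ n (i + 1))
        (Submodule.mem_span_singleton_self (n (i + 1)))]
      rw [LinearIsometryEquiv.inner_map_map]
    simp only [D, mem_preimage, mem_ofPred_eq, h1, h2]
    tauto
  have hD0 : ∀ i, μ.real (D i) = μ.real (D 0) := fun i => by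
    induction i with
    | zero => rfl
    | succ i ih => rw [← ih, measureReal_def, hstep, measureReal_def]
  have hDm : ∀ i, MeasurableSet (D i) := fun i => by
    have hh : ∀ j, MeasurableSet {x : EuclideanSpace ℝ (Fin k) | 0 ≤ (inner ℝ (n j) x : ℝ)} :=
      fun j => (isClosed_le continuous_const (by fun_prop)).measurableSet
    exact (MeasurableSet.iff (hh i) (hh (i + 1))).compl
  -- Double counting: the expected number of wedges containing `x` is `N * μ.real (D 0)`, while
  -- almost every `x` sees only as many sign changes as a sinusoid allows. The additive `1`
  -- disappears for large `N`.
  have hbound : ∀ N : ℕ, N * μ.real (D 0) ≤ N * (θ / Real.pi) + 1 := fun N => by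
    have hsum : N * μ.real (D 0) =
        ∫ x, ∑ i ∈ Finset.range N, (D i).indicator (fun _ => (1 : ℝ)) x ∂μ := by
      rw [integral_finsetSum _ fun i _ => (integrable_const _).indicator (hDm i)]
      simp [integral_indicator_const, hDm, hD0]
    rw [hsum]
    have hint : ∫ _, (N * (θ / Real.pi) + 1) ∂μ = N * (θ / Real.pi) + 1 := by simp
    rw [← hint]
    refine integral_mono_ae
      (integrable_finsetSum _ fun i _ => (integrable_const _).indicator (hDm i))
      (integrable_const _) ?_
    have hae : ∀ᵐ x ∂μ, ∀ i, (inner ℝ (n i) x : ℝ) ≠ 0 := ae_all_iff.2 fun i =>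
      ae_uniform_inner_ne_zero (norm_ne_zero_iff.1 (by rw [hnnorm]; exact one_ne_zero))
    filter_upwards [hae] with x hx
    have hnx : ∀ i : ℕ, (inner ℝ (n i) x : ℝ) =
        inner ℝ u x * Real.cos (i * θ) + inner ℝ v x * Real.sin (i * θ) := fun i => by
      simp only [n, inner_add_left, inner_smul_left]
      simp [mul_comm]
    have := sum_sign_changes_le (inner ℝ u x) (inner ℝ v x) hθ N fun i => hnx i ▸ hx i
    refine le_trans (le_of_eq ?_) this
    refine Finset.sum_congr rfl fun i _ => ?_
    simp only [indicator, D, mem_ofPred_eq, hnx]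
  have hD : {x | ¬ (0 ≤ (inner ℝ u x : ℝ) ↔
      0 ≤ (inner ℝ (Real.cos θ • u + Real.sin θ • v) x : ℝ))} = D 0 := by
    simp [D, n]
  rw [hD]
  by_contra! hlt
  obtain ⟨N, hN⟩ := exists_nat_gt (1 / (μ.real (D 0) - θ / Real.pi))
  rw [div_lt_iff₀ (by linarith)] at hN
  have := hbound N
  nlinarith

/-! ### From normal vectors to errors -/

theorem halfSpace_smul {c : ℝ} (hc : 0 < c) (ω : EuclideanSpace ℝ (Fin k)) :
    halfSpace (c • ω) = halfSpace ω := by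
  ext x
  simp [halfSpace, inner_smul_left, mul_nonneg_iff_of_pos_left hc]

theorem mem_halfSpace_iff {ω x : EuclideanSpace ℝ (Fin k)} (hx : x ∈ halfBall k) :
    x ∈ halfSpace ω ↔ 0 ≤ (inner ℝ ω x : ℝ) :=
  ⟨fun h => h.2, fun h => ⟨hx, h⟩⟩

/-- The error between two half-spaces is at most the tangent of their angle, divided by `π`. -/
theorem err_halfSpace_le {ω ν : EuclideanSpace ℝ (Fin k)} (hω : ‖ω‖ = 1) {C g : ℝ} (hC : 0 < C)
    (hν : (inner ℝ ω ν : ℝ) = C) (hg : ‖ν - C • ω‖ ≤ g * C) :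
    err (halfBall k) (halfSpace ν) (halfSpace ω) ≤ g / Real.pi := by
  have hg0 : 0 ≤ g := by
    by_contra! h
    have := norm_nonneg (ν - C • ω)
    nlinarith
  set w := ν - C • ω with hw
  rcases eq_or_ne w 0 with h0 | h0
  · have : ν = C • ω := sub_eq_zero.1 h0
    rw [this, halfSpace_smul hC]
    simp only [err, not_true_eq_false, ofPred_false, measureReal_empty]
    positivity
  have hwn : 0 < ‖w‖ := norm_pos_iff.2 h0
  set θ := Real.arctan (‖w‖ / C) with hθ
  have hcos : 0 < Real.cos θ := Real.cos_arctan_pos _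
  have htan : Real.sin θ = ‖w‖ / C * Real.cos θ := by
    rw [← Real.tan_arctan (‖w‖ / C), ← hθ, Real.tan_mul_cos hcos.ne']
  have hθ0 : 0 ≤ θ := Real.arctan_nonneg.2 (by positivity)
  have hθg : θ ≤ g := by
    have h1 : θ ≤ ‖w‖ / C := by
      rw [← Real.tan_arctan (‖w‖ / C)]
      exact Real.le_tan hθ0 (Real.arctan_lt_pi_div_two _)
    exact h1.trans ((div_le_iff₀ hC).2 hg)
  have hν' : ν = (C / Real.cos θ) • (Real.cos θ • ω + Real.sin θ • (‖w‖⁻¹ • w)) := by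
    have e1 : C / Real.cos θ * Real.cos θ = C := by field_simp
    have e2 : C / Real.cos θ * Real.sin θ * ‖w‖⁻¹ = 1 := by
      rw [htan]; field_simp
    rw [smul_add, smul_smul, smul_smul, smul_smul, e1, e2, hw]
    module
  have horth : (inner ℝ ω (‖w‖⁻¹ • w) : ℝ) = 0 := by
    rw [inner_smul_right, hw, inner_sub_right, inner_smul_right, hν, real_inner_self_eq_norm_sq, hω]
    ring
  have hv : ‖‖w‖⁻¹ • w‖ = 1 := by
    rw [norm_smul, norm_inv, norm_norm, inv_mul_cancel₀ hwn.ne']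
  rw [hν', halfSpace_smul (by positivity)]
  refine le_trans ?_ ((uniform_wedge_le hω hv horth hθ0).trans
    (div_le_div_of_nonneg_right hθg Real.pi_pos.le))
  refine measureReal_mono (fun x hx => ?_)
  by_cases hxb : x ∈ halfBall k
  · simpa only [mem_ofPred_eq, mem_halfSpace_iff hxb] using hx
  · exact absurd ⟨fun h => absurd h.1 hxb, fun h => absurd h.1 hxb⟩ hx

/-! ### Contrastive examples for half-spaces -/

/-- The product form is symmetric in the two labels and a closed condition, so it passes to limits
of oppositely labelled points. -/
theorem inner_mul_inner_nonpos_of_label_ne {ω x y : EuclideanSpace ℝ (Fin k)}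
    (hx : x ∈ halfBall k) (hy : y ∈ halfBall k)
    (h : ¬ (y ∈ halfSpace ω ↔ x ∈ halfSpace ω)) :
    (inner ℝ ω x : ℝ) * inner ℝ ω y ≤ 0 := by
  rw [mem_halfSpace_iff hx, mem_halfSpace_iff hy] at h
  by_contra! hpos
  rcases pos_and_pos_or_neg_and_neg_of_mul_pos hpos with h1 | h1
  · exact h ⟨fun _ => h1.1.le, fun _ => h1.2.le⟩
  · exact h ⟨fun h2 => absurd h2 (not_le.2 h1.2), fun h2 => absurd h2 (not_le.2 h1.1)⟩

theorem abs_inner_le_abs_inner_sub {ω x y : EuclideanSpace ℝ (Fin k)}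
    (h : (inner ℝ ω x : ℝ) * inner ℝ ω y ≤ 0) :
    |(inner ℝ ω x : ℝ)| ≤ |(inner ℝ ω (x - y) : ℝ)| := by
  rw [inner_sub_right]
  apply sq_le_sq.1
  nlinarith [sq_nonneg (inner ℝ ω y : ℝ)]

theorem abs_inner_le_dist {ω x y : EuclideanSpace ℝ (Fin k)} (hω : ‖ω‖ = 1)
    (h : (inner ℝ ω x : ℝ) * inner ℝ ω y ≤ 0) : |(inner ℝ ω x : ℝ)| ≤ dist x y := by
  have := (abs_inner_le_abs_inner_sub h).trans (abs_real_inner_le_norm ω (x - y))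
  rwa [hω, one_mul, ← dist_eq_norm] at this

theorem inner_mul_inner_nonpos_of_mem_oppositeLimits {ω x y : EuclideanSpace ℝ (Fin k)}
    (hx : x ∈ halfBall k) (hy : y ∈ oppositeLimits (halfBall k) (halfSpace ω) x) :
    (inner ℝ ω x : ℝ) * inner ℝ ω y ≤ 0 := by
  obtain ⟨-, u, hu, -, hlim⟩ := hy
  have : Tendsto (fun n => (inner ℝ ω x : ℝ) * inner ℝ ω (u n)) atTop
      (𝓝 ((inner ℝ ω x : ℝ) * inner ℝ ω y)) :=
    (tendsto_const_nhds.inner hlim).const_mul _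
  exact le_of_tendsto' this fun n => inner_mul_inner_nonpos_of_label_ne hx (hu n).1 (hu n).2

theorem dist_sub_inner_smul {ω : EuclideanSpace ℝ (Fin k)} (hω : ‖ω‖ = 1)
    (x : EuclideanSpace ℝ (Fin k)) :
    dist x (x - (inner ℝ ω x : ℝ) • ω) = |(inner ℝ ω x : ℝ)| := by
  simp [norm_smul, hω]

theorem norm_sub_smul_inner_smul_sq {ω : EuclideanSpace ℝ (Fin k)} (hω : ‖ω‖ = 1)
    (x : EuclideanSpace ℝ (Fin k)) (a : ℝ) :
    ‖x - (a * inner ℝ ω x) • ω‖ ^ 2 = ‖x‖ ^ 2 - a * (2 - a) * (inner ℝ ω x : ℝ) ^ 2 := by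
  rw [norm_sub_sq_real, inner_smul_right, real_inner_comm, norm_smul, hω, Real.norm_eq_abs, mul_one,
    sq_abs]
  ring

/-- The foot of the perpendicular is a closest limit of oppositely labelled points. -/
theorem sub_inner_smul_mem_minDistCE {ω x : EuclideanSpace ℝ (Fin k)} (hω : ‖ω‖ = 1)
    (hx : x ∈ halfBall k) (h0 : (inner ℝ ω x : ℝ) ≠ 0) :
    x - (inner ℝ ω x : ℝ) • ω ∈ minDistCE (halfBall k) (halfSpace ω) x := by
  set c : ℝ := inner ℝ ω x with hc
  -- `a = 1` is the foot and `a = 2` the mirror image of `x`, which has the same norm. Values of `a`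
  -- slightly above `1` give points strictly across the boundary, still in the ball and converging
  -- to the foot.
  have hball : ∀ a : ℝ, 0 ≤ a → a ≤ 2 → x - (a * c) • ω ∈ halfBall k := fun a ha ha2 => by
    rw [mem_halfBall] at hx ⊢
    refine le_trans (le_of_sq_le_sq ?_ (norm_nonneg _)) hx
    rw [hc, norm_sub_smul_inner_smul_sq hω]
    nlinarith [mul_nonneg (mul_nonneg ha (sub_nonneg.2 ha2)) (sq_nonneg (inner ℝ ω x : ℝ))]
  have hlim : Tendsto (fun n : ℕ => x - ((1 + 1 / ((n : ℝ) + 1)) * c) • ω) atTop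
      (𝓝 (x - c • ω)) := by
    have h1 : Tendsto (fun n : ℕ => 1 + 1 / ((n : ℝ) + 1)) atTop (𝓝 (1 + 0)) :=
      tendsto_one_div_add_atTop_nhds_zero_nat.const_add 1
    have h2 := ((h1.mul_const c).smul_const ω).const_sub x
    simpa using h2
  refine ⟨⟨by simpa using hball 1 zero_le_one one_le_two,
    fun n => x - ((1 + 1 / ((n : ℝ) + 1)) * c) • ω, fun n => ?_, hlim.cauchySeq, hlim⟩,
    fun z hz => ?_⟩
  · have hn : 0 < 1 / ((n : ℝ) + 1) := by positivity
    have hn1 : 1 / ((n : ℝ) + 1) ≤ 1 := by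
      rw [div_le_one (by positivity)]
      have : (0 : ℝ) ≤ n := n.cast_nonneg
      linarith
    have hm := hball (1 + 1 / ((n : ℝ) + 1)) (by positivity) (by linarith)
    refine ⟨hm, ?_⟩
    have hin : (inner ℝ ω (x - ((1 + 1 / ((n : ℝ) + 1)) * c) • ω) : ℝ) =
        -(1 / ((n : ℝ) + 1) * c) := by
      rw [inner_sub_right, inner_smul_right, real_inner_self_eq_norm_sq, hω, ← hc]
      ring
    rw [mem_halfSpace_iff hm, mem_halfSpace_iff hx, hin, ← hc]
    rcases lt_or_gt_of_ne h0 with h | h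
    · have := mul_neg_of_pos_of_neg hn h
      exact fun hh => absurd (hh.1 (by linarith)) (by linarith)
    · have := mul_pos hn h
      exact fun hh => absurd (hh.2 h.le) (by linarith)
  · rw [hc, dist_sub_inner_smul hω]
    exact abs_inner_le_dist hω (inner_mul_inner_nonpos_of_mem_oppositeLimits hx hz)

/-- The foot of the perpendicular is the only closest limit of oppositely labelled points. -/
theorem eq_of_mem_minDistCE {ω x y : EuclideanSpace ℝ (Fin k)} (hω : ‖ω‖ = 1)
    (hx : x ∈ halfBall k) (h0 : (inner ℝ ω x : ℝ) ≠ 0)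
    (hy : y ∈ minDistCE (halfBall k) (halfSpace ω) x) :
    y = x - (inner ℝ ω x : ℝ) • ω := by
  have h1 := hy.2 _ (sub_inner_smul_mem_minDistCE hω hx h0).1
  have h2 := inner_mul_inner_nonpos_of_mem_oppositeLimits hx hy.1
  rw [dist_sub_inner_smul hω, dist_eq_norm] at h1
  -- With `c = ⟨ω, x⟩`, expand the square: `‖x - y‖ ^ 2 ≤ c ^ 2` by minimality, and `c * ⟨ω, x - y⟩
  -- ≥ c ^ 2` because `y` is not strictly on the side of `x`.
  have h3 : ‖x - y - (inner ℝ ω x : ℝ) • ω‖ ^ 2 ≤ 0 := by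
    rw [norm_sub_sq_real, inner_smul_right, real_inner_comm ω (x - y), norm_smul, hω,
      Real.norm_eq_abs, mul_one, sq_abs, inner_sub_right]
    have h4 : ‖x - y‖ ^ 2 ≤ (inner ℝ ω x : ℝ) ^ 2 := by
      rw [← sq_abs (inner ℝ ω x : ℝ)]
      gcongr
    nlinarith
  have h5 : x - y - (inner ℝ ω x : ℝ) • ω = 0 := by
    rw [← norm_eq_zero]
    exact pow_eq_zero_iff two_ne_zero |>.1 (le_antisymm h3 (sq_nonneg _))
  rw [← sub_eq_zero, ← neg_eq_zero, ← h5]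
  abel

/-- The foot itself may carry the label of `x`, so positive slack is needed to reach an oppositely
labelled point near it. Nonemptiness rules out the oracle's arbitrary answer. -/
theorem approxCE_nonempty {ω x : EuclideanSpace ℝ (Fin k)} {f : ℝ≥0 → ℝ≥0} (hω : ‖ω‖ = 1)
    (hx : x ∈ halfBall k) (h0 : (inner ℝ ω x : ℝ) ≠ 0) (hf : ∀ t, 0 < t → 0 < f t) :
    (approxCE (halfBall k) f (halfSpace ω) x).Nonempty := by
  have hp := sub_inner_smul_mem_minDistCE hω hx h0
  set p := x - (inner ℝ ω x : ℝ) • ω with hpdef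
  have hpos : 0 < f (nndist x p) := by
    apply hf
    rw [← NNReal.coe_pos, coe_nndist, hpdef, dist_sub_inner_smul hω]
    exact abs_pos.2 h0
  obtain ⟨-, u, hu, -, hlim⟩ := hp.1
  obtain ⟨n, hn⟩ := (Metric.tendsto_atTop.1 hlim (f (nndist x p)) hpos)
  exact ⟨u n, (hu n).1, ⟨p, hp, by rw [← NNReal.coe_le_coe, coe_nndist]; exact (hn n le_rfl).le⟩,
    (hu n).2⟩

theorem norm_sub_le_of_mem_approxCE {ω x y : EuclideanSpace ℝ (Fin k)} {f : ℝ≥0 → ℝ≥0}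
    (hω : ‖ω‖ = 1) (hx : x ∈ halfBall k) (h0 : (inner ℝ ω x : ℝ) ≠ 0)
    (hy : y ∈ approxCE (halfBall k) f (halfSpace ω) x) :
    ‖y - (x - (inner ℝ ω x : ℝ) • ω)‖ ≤ f ‖(inner ℝ ω x : ℝ)‖₊ := by
  obtain ⟨-, ⟨p, hp, hle⟩, -⟩ := hy
  rw [eq_of_mem_minDistCE hω hx h0 hp] at hle
  have : nndist x (x - (inner ℝ ω x : ℝ) • ω) = ‖(inner ℝ ω x : ℝ)‖₊ := by
    rw [← NNReal.coe_inj, coe_nndist, dist_sub_inner_smul hω]; simp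
  rw [this, ← NNReal.coe_le_coe, coe_nndist, dist_eq_norm] at hle
  exact hle

/-! ### The error of the half-space read off from a pair -/

theorem err_le_of_norm_sub_le {ω x y : EuclideanSpace ℝ (Fin k)} (hω : ‖ω‖ = 1) {σ t d : ℝ}
    (ht : 0 < t) (hσ : |σ| = 1) (hσx : σ * inner ℝ ω x = t) (hσy : σ * inner ℝ ω y ≤ 0)
    (hd : ‖y - (x - (inner ℝ ω x : ℝ) • ω)‖ ≤ d) :
    err (halfBall k) (halfSpace (σ • (x - y))) (halfSpace ω) ≤ d / t / Real.pi := by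
  set C : ℝ := inner ℝ ω (σ • (x - y)) with hC
  have hCt : t ≤ C := by
    rw [hC, inner_smul_right, inner_sub_right]
    linarith
  refine err_halfSpace_le hω (ht.trans_le hCt) hC.symm ?_
  set q := y - (x - (inner ℝ ω x : ℝ) • ω) with hq
  -- The segment from `x` to its foot is parallel to `ω`, so the tangential part of `x - y` comes
  -- only from the deviation `q` of `y` from the foot.
  have hw : σ • (x - y) - C • ω = -(σ • (q - (1 * inner ℝ ω q) • ω)) := by
    have hωω : (inner ℝ ω ω : ℝ) = 1 := by simp [hω]
    rw [hC, hq, inner_smul_right]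
    simp only [inner_sub_right, inner_smul_right, hωω]
    module
  have hn : ‖q - (1 * inner ℝ ω q) • ω‖ ≤ ‖q‖ := by
    refine le_of_sq_le_sq ?_ (norm_nonneg _)
    rw [norm_sub_smul_inner_smul_sq hω]
    nlinarith [sq_nonneg (inner ℝ ω q : ℝ)]
  rw [hw, norm_neg, norm_smul, Real.norm_eq_abs, hσ, one_mul]
  have hd0 : 0 ≤ d := (norm_nonneg _).trans hd
  calc _ ≤ d := hn.trans hd
    _ = d / t * t := by field_simp
    _ ≤ d / t * C := by gcongr

/-- Learning from a single pair that the approximate minimum distance mechanism allows. -/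
theorem err_pairHalfSpace_le {ω x y : EuclideanSpace ℝ (Fin k)} {f : ℝ≥0 → ℝ≥0}
    (hω : ‖ω‖ = 1) (hx : x ∈ halfBall k) (h0 : (inner ℝ ω x : ℝ) ≠ 0)
    (hy : y ∈ approxCE (halfBall k) f (halfSpace ω) x) :
    err (halfBall k) (pairHalfSpace (labelledPair (halfSpace ω) x y)) (halfSpace ω) ≤
      ((f ‖(inner ℝ ω x : ℝ)‖₊ / ‖(inner ℝ ω x : ℝ)‖₊ : ℝ≥0) : ℝ) / Real.pi := by
  have hd := norm_sub_le_of_mem_approxCE hω hx h0 hy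
  have hyx := hy.2.2
  have ht : 0 < |(inner ℝ ω x : ℝ)| := abs_pos.2 h0
  rw [NNReal.coe_div, coe_nnnorm, Real.norm_eq_abs]
  by_cases hxl : x ∈ halfSpace ω
  · have hyl : y ∉ halfSpace ω := fun h => hyx ⟨fun _ => hxl, fun _ => h⟩
    have e : pairHalfSpace (labelledPair (halfSpace ω) x y) = halfSpace ((1 : ℝ) • (x - y)) := by
      simp [pairHalfSpace, labelledPair, hxl, hyl]
    rw [e]
    refine err_le_of_norm_sub_le hω ht (by simp) ?_ ?_ hd
    · rw [one_mul, abs_of_nonneg ((mem_halfSpace_iff hx).1 hxl)]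
    · rw [one_mul]
      exact (not_le.1 fun h => hyl ((mem_halfSpace_iff hy.1).2 h)).le
  · have hyl : y ∈ halfSpace ω := by tauto
    have e : pairHalfSpace (labelledPair (halfSpace ω) x y) = halfSpace ((-1 : ℝ) • (x - y)) := by
      simp [pairHalfSpace, labelledPair, hxl, hyl]
    rw [e]
    refine err_le_of_norm_sub_le hω ht (by simp) ?_ ?_ hd
    · rw [abs_of_neg (not_le.1 fun h => hxl ((mem_halfSpace_iff hx).2 h))]
      ring
    · have := (mem_halfSpace_iff hy.1).1 hyl
      linarith

theorem dist_le_of_mem_approxCE {ω x y : EuclideanSpace ℝ (Fin k)} {f : ℝ≥0 → ℝ≥0}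
    (hω : ‖ω‖ = 1) (hf : ∀ t, f t ≤ t ^ 2) (hx : x ∈ halfBall k) (h0 : (inner ℝ ω x : ℝ) ≠ 0)
    (hy : y ∈ approxCE (halfBall k) f (halfSpace ω) x) :
    dist x y ≤ 3 / 2 * |(inner ℝ ω x : ℝ)| := by
  have hd := norm_sub_le_of_mem_approxCE hω hx h0 hy
  have hft : (f ‖(inner ℝ ω x : ℝ)‖₊ : ℝ) ≤ |(inner ℝ ω x : ℝ)| ^ 2 := by
    exact_mod_cast hf ‖(inner ℝ ω x : ℝ)‖₊
  have ht : |(inner ℝ ω x : ℝ)| ≤ 1 / 2 := by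
    have := abs_real_inner_le_norm ω x
    rw [hω] at this
    linarith [mem_halfBall.1 hx]
  have htri := dist_triangle x (x - (inner ℝ ω x : ℝ) • ω) y
  rw [dist_sub_inner_smul hω, dist_comm (x - (inner ℝ ω x : ℝ) • ω) y,
    dist_eq_norm y (x - (inner ℝ ω x : ℝ) • ω)] at htri
  nlinarith [abs_nonneg (inner ℝ ω x : ℝ)]

/-- Division by zero gives `g 0 = 0`, which matches the convention for `g` and forces `g` to be
positive elsewhere. -/
theorem pos_of_strictMono_div {f : ℝ≥0 → ℝ≥0} (hmono : StrictMono fun t : ℝ≥0 => f t / t)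
    {t : ℝ≥0} (ht : 0 < t) : 0 < f t := by
  have h : f 0 / 0 < f t / t := hmono ht
  rw [div_zero] at h
  by_contra! h0
  rw [nonpos_iff_eq_zero.1 h0, zero_div] at h
  exact lt_irrefl _ h

/-- A pair `(x, y)` at least as close as another pair whose primary example is near the boundary
of the target determines a half-space with small error. -/
theorem err_pairHalfSpace_le_of_dist_le {ω x y x' y' : EuclideanSpace ℝ (Fin k)} (hω : ‖ω‖ = 1)
    {f : ℝ≥0 → ℝ≥0} (hf : ∀ t, f t ≤ t ^ 2) (hmono : Monotone fun t : ℝ≥0 => f t / t)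
    {ε : ℝ} {r : ℝ≥0} (hr : ((f r / r : ℝ≥0) : ℝ) = Real.pi * ε)
    (hx : x ∈ halfBall k) (h0 : (inner ℝ ω x : ℝ) ≠ 0)
    (hy : y ∈ approxCE (halfBall k) f (halfSpace ω) x)
    (hx' : x' ∈ halfBall k) (h0' : (inner ℝ ω x' : ℝ) ≠ 0)
    (hy' : y' ∈ approxCE (halfBall k) f (halfSpace ω) x')
    (hdist : dist x y ≤ dist x' y') (hx'r : |(inner ℝ ω x' : ℝ)| ≤ 2 / 3 * r) :
    err (halfBall k) (pairHalfSpace (labelledPair (halfSpace ω) x y)) (halfSpace ω) ≤ ε := by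
  have h1 := abs_inner_le_dist hω (inner_mul_inner_nonpos_of_label_ne hx hy.1 hy.2.2)
  have h2 := dist_le_of_mem_approxCE hω hf hx' h0' hy'
  have hxr : ‖(inner ℝ ω x : ℝ)‖₊ ≤ r := by
    rw [← NNReal.coe_le_coe, coe_nnnorm, Real.norm_eq_abs]
    linarith
  have h3 := err_pairHalfSpace_le hω hx h0 hy
  have h4 : ((f ‖(inner ℝ ω x : ℝ)‖₊ / ‖(inner ℝ ω x : ℝ)‖₊ : ℝ≥0) : ℝ) ≤ Real.pi * ε := by
    rw [← hr]
    exact NNReal.coe_le_coe.2 (hmono hxr)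
  have h5 := h3.trans (div_le_div_of_nonneg_right h4 Real.pi_pos.le)
  rwa [mul_div_cancel_left₀ _ Real.pi_ne_zero] at h5

/-- A learner that uses a closest pair fails only if all primary examples are far away from the
boundary of the target, apart from degenerate samples. -/
theorem failureSet_subset {ω : EuclideanSpace ℝ (Fin k)} (hω : ‖ω‖ = 1) {f : ℝ≥0 → ℝ≥0}
    (hf : ∀ t, f t ≤ t ^ 2) (hmono : StrictMono fun t : ℝ≥0 => f t / t) {ε : ℝ} {r : ℝ≥0}
    (hr : ((f r / r : ℝ≥0) : ℝ) = Real.pi * ε) {A : PassiveLearner (HHS k)}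
    (hA : UsesClosestPair A) (m : ℕ) :
    failureSet (halfBall k) (approxCE (halfBall k) f) A (halfSpace ω) m ε ⊆
      univ.pi (fun _ => {x | 2 / 3 * (r : ℝ) < |inner ℝ ω x|}) ∪
        {x | ¬ ∀ i, x i ∈ halfBall k ∧ (inner ℝ ω (x i) : ℝ) ≠ 0} := by
  rintro x ⟨y, hy, herr⟩
  by_cases hgood : ∀ i, x i ∈ halfBall k ∧ (inner ℝ ω (x i) : ℝ) ≠ 0
  swap
  · exact Or.inr hgood
  refine Or.inl fun j _ => ?_
  by_contra hj
  rw [mem_ofPred_eq, not_lt] at hj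
  have hyCE : ∀ i, y i ∈ approxCE (halfBall k) f (halfSpace ω) (x i) := fun i =>
    (hy i).2 (approxCE_nonempty hω (hgood i).1 (hgood i).2 fun _ => pos_of_strictMono_div hmono)
  obtain ⟨p, ⟨c, hc⟩, hmin, hhyp⟩ := hA (range fun i => labelledPair (halfSpace ω) (x i) (y i))
    (finite_range _) ⟨_, mem_range_self j⟩
  subst hc
  rw [hhyp] at herr
  have hcj : dist (x c) (y c) ≤ dist (x j) (y j) :=
    hmin (labelledPair (halfSpace ω) (x j) (y j)) ⟨j, rfl⟩
  exact herr.not_ge (err_pairHalfSpace_le_of_dist_le hω hf hmono.monotone hr (hgood c).1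
    (hgood c).2 (hyCE c) (hgood j).1 (hgood j).2 (hyCE j) hcj hj)

/-! ### Failure probability and sample size -/

/-- Strictness comes from `1 - q < exp (-q)` and requires `m ≠ 0`: for `δ = 1` the logarithm
vanishes, and an empty sample would give only equality. -/
theorem ofReal_one_sub_pow_lt {q δ : ℝ} (hq : 0 < q) (hδ : 0 < δ) {m : ℕ} (hm : 1 ≤ m)
    (hlog : Real.log (1 / δ) / q ≤ m) : ENNReal.ofReal (1 - q) ^ m < ENNReal.ofReal δ := by
  have hm0 : m ≠ 0 := by omega
  rcases le_total 1 q with h | h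
  · rw [ENNReal.ofReal_of_nonpos (by linarith), zero_pow hm0]
    exact ENNReal.ofReal_pos.2 hδ
  · rw [← ENNReal.ofReal_pow (by linarith), ENNReal.ofReal_lt_ofReal_iff hδ]
    have h1 : 1 - q < Real.exp (-q) := by
      have := Real.add_one_lt_exp (x := -q) (by linarith)
      linarith
    calc (1 - q) ^ m < Real.exp (-q) ^ m := pow_lt_pow_left₀ h1 (by linarith) hm0
      _ = Real.exp (m * -q) := (Real.exp_nat_mul _ _).symm
      _ ≤ Real.exp (Real.log δ) := by
        gcongr
        rw [div_le_iff₀ hq, one_div, Real.log_inv] at hlog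
        linarith
      _ = δ := Real.exp_log hδ

/-- The degenerate target `ω = 0` has no boundary and the oracle answers arbitrarily, but all labels
are positive, so the learner's default is exactly right. -/
theorem failureSet_univ_target {f : ℝ≥0 → ℝ≥0} {ε : ℝ} (hε : 0 < ε)
    {A : PassiveLearner (HHS k)} (hA : UsesClosestPair A) {m : ℕ} (hm : 1 ≤ m) :
    failureSet (halfBall k) (approxCE (halfBall k) f) A (halfSpace 0) m ε ⊆
      {x | ¬ ∀ i, x i ∈ halfBall k} := by
  rintro x ⟨y, hy, herr⟩ hx
  obtain ⟨p, ⟨c, rfl⟩, -, hhyp⟩ := hA (range fun i => labelledPair (halfSpace 0) (x i) (y i))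
    (finite_range _) ⟨_, ⟨⟨0, hm⟩, rfl⟩⟩
  have h0 : ∀ z ∈ halfBall k, z ∈ halfSpace 0 := fun z hz => by
    simp [mem_halfSpace_iff hz]
  have e : pairHalfSpace (labelledPair (halfSpace 0) (x c) (y c)) = halfSpace 0 := by
    simp [pairHalfSpace, labelledPair, h0 _ (hx c), h0 _ (hy c).1]
  rw [hhyp, e] at herr
  simp only [err, not_true_eq_false, ofPred_false, measureReal_empty] at herr
  linarith

theorem suffices_of_usesClosestPair {f : ℝ≥0 → ℝ≥0} (hf : ∀ t, f t ≤ t ^ 2)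
    (hmono : StrictMono fun t : ℝ≥0 => f t / t) {ε δ : ℝ} (hε : 0 < ε) (hδ : 0 < δ) {r : ℝ≥0}
    (hr0 : 0 < r) (hr : ((f r / r : ℝ≥0) : ℝ) = Real.pi * ε) {A : PassiveLearner (HHS k)}
    (hA : UsesClosestPair A) {n : ℕ} (hn : 1 ≤ n)
    (hlog : Real.log (1 / δ) / (4 / 3 * r) ≤ n) :
    Suffices (halfBall k) (approxCE (halfBall k) f) A ε δ n := by
  rintro _ ⟨ω, rfl⟩ m hnm
  have hm : 1 ≤ m := hn.trans hnm
  have hball₁ := ae_uniform_mem_halfBall k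
  have hball : ∀ᵐ x ∂Measure.pi (fun _ : Fin m => uniform (halfBall k)),
      ∀ i, x i ∈ halfBall k :=
    ae_all_iff.2 fun i => Measure.tendsto_eval_ae_ae.eventually hball₁
  rcases eq_or_ne ω 0 with rfl | h0
  · rw [measure_mono_null (failureSet_univ_target hε hA hm) (ae_iff.1 hball)]
    exact ENNReal.ofReal_pos.2 hδ
  · obtain ⟨ω', hω', he⟩ : ∃ ω' : EuclideanSpace ℝ (Fin k), ‖ω'‖ = 1 ∧
        halfSpace ω = halfSpace ω' :=
      ⟨‖ω‖⁻¹ • ω, by rw [norm_smul, norm_inv, norm_norm, inv_mul_cancel₀ (norm_ne_zero_iff.2 h0)],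
        (halfSpace_smul (inv_pos.2 (norm_pos_iff.2 h0)) ω).symm⟩
    have hω0 : ω' ≠ 0 := norm_ne_zero_iff.1 (by rw [hω']; exact one_ne_zero)
    have hne : ∀ᵐ x ∂Measure.pi (fun _ : Fin m => uniform (halfBall k)),
        ∀ i, x i ∈ halfBall k ∧ (inner ℝ ω' (x i) : ℝ) ≠ 0 :=
      ae_all_iff.2 fun i => (Measure.tendsto_eval_ae_ae
        (μ := fun _ : Fin m => uniform (halfBall k)) (i := i)).eventually
        (hball₁.and (ae_uniform_inner_ne_zero hω0))
    rw [he]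
    -- Monotonicity of outer measure suffices; measurability of the adversarial failure set is never
    -- needed.
    calc _ ≤ _ := measure_mono (failureSet_subset hω' hf hmono hr hA m)
      _ ≤ _ := measure_union_le _ _
      _ = uniform (halfBall k) {x | 2 / 3 * (r : ℝ) < |inner ℝ ω' x|} ^ m := by
        rw [ae_iff.1 hne, add_zero, Measure.pi_pi]
        simp
      _ ≤ ENNReal.ofReal (1 - 4 / 3 * r) ^ m := by
        gcongr
        refine (uniform_slab_compl_le hω' (by positivity)).trans_eq ?_
        congr 1
        ring
      _ < ENNReal.ofReal δ := by
        refine ofReal_one_sub_pow_lt (by positivity) hδ hm (hlog.trans ?_)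
        exact_mod_cast hnm

theorem pairHalfSpace_mem_HHS (p : ExamplePair (EuclideanSpace ℝ (Fin k))) :
    pairHalfSpace p ∈ HHS k := by
  unfold pairHalfSpace
  split_ifs <;> exact mem_range_self _

theorem exists_usesClosestPair (k : ℕ) : ∃ A : PassiveLearner (HHS k), UsesClosestPair A := by
  have h : ∀ S : Set (ExamplePair (EuclideanSpace ℝ (Fin k))), ∃ H ∈ HHS k,
      S.Finite → S.Nonempty → ∃ p ∈ S,
        (∀ q ∈ S, dist p.1.1 p.2.1 ≤ dist q.1.1 q.2.1) ∧ H = pairHalfSpace p := fun S => by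
    by_cases hS : S.Finite ∧ S.Nonempty
    · obtain ⟨p, hp, hmin⟩ := exists_min_image S (fun p => dist p.1.1 p.2.1) hS.1 hS.2
      exact ⟨_, pairHalfSpace_mem_HHS p, fun _ _ => ⟨p, hp, hmin, rfl⟩⟩
    · exact ⟨_, mem_range_self 0, fun h1 h2 => absurd ⟨h1, h2⟩ hS⟩
  choose H hH hmin using h
  exact ⟨⟨H, hH⟩, hmin⟩

theorem learnerSampleComplexity_le_of_suffices {A : PassiveLearner (HHS k)}
    {CE : Set (EuclideanSpace ℝ (Fin k)) → EuclideanSpace ℝ (Fin k) →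
      Set (EuclideanSpace ℝ (Fin k))} {ε δ : ℝ} {n : ℕ}
    (h : Suffices (halfBall k) CE A ε δ n) :
    learnerSampleComplexity (halfBall k) CE A ε δ ≤ n :=
  iInf₂_le n h

theorem learnerSampleComplexity_le_ofReal {f : ℝ≥0 → ℝ≥0} (hf : ∀ t, f t ≤ t ^ 2)
    (hmono : StrictMono fun t : ℝ≥0 => f t / t) {ε δ : ℝ} (hε : 0 < ε) (hδ : 0 < δ) {r : ℝ≥0}
    (hr : ((f r / r : ℝ≥0) : ℝ) = Real.pi * ε) {A : PassiveLearner (HHS k)}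
    (hA : UsesClosestPair A) :
    ((learnerSampleComplexity (halfBall k) (approxCE (halfBall k) f) A ε δ : ℕ∞) : ℝ≥0∞) ≤
      ENNReal.ofReal (max 1 (3 / 2 * (Real.log (1 / δ) / r))) := by
  have hr0 : 0 < r := by
    by_contra! h
    rw [nonpos_iff_eq_zero.1 h, div_zero, NNReal.coe_zero] at hr
    have := mul_pos Real.pi_pos hε
    linarith
  set L := Real.log (1 / δ) / (4 / 3 * r) with hL
  have h32 : 3 / 2 * (Real.log (1 / δ) / r) = 2 * L := by
    have : (r : ℝ) ≠ 0 := by positivity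
    rw [hL]; field_simp; ring
  have hle : L ≤ (max 1 ⌈L⌉₊ : ℕ) :=
    (Nat.le_ceil L).trans (by exact_mod_cast le_max_right _ _)
  have h1 := learnerSampleComplexity_le_of_suffices
    (suffices_of_usesClosestPair hf hmono hε hδ hr0 hr hA (le_max_left 1 ⌈L⌉₊) hle)
  -- Rounding up costs at most a factor `2` once `L ≥ 1`. Together with the `3 / 4` from the slab
  -- this gives the constant `3 / 2`.
  have h2 : ((max 1 ⌈L⌉₊ : ℕ) : ℝ) ≤ max 1 (2 * L) := by
    rw [Nat.cast_max, Nat.cast_one]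
    refine max_le (le_max_left _ _) ?_
    rcases le_total L 1 with h | h
    · refine le_max_of_le_left ?_
      exact_mod_cast Nat.ceil_le.2 (by exact_mod_cast h)
    · refine le_max_of_le_right ?_
      have := Nat.ceil_lt_add_one (zero_le_one.trans h)
      linarith
  rw [h32]
  calc _ ≤ (((max 1 ⌈L⌉₊ : ℕ) : ℕ∞) : ℝ≥0∞) := ENat.toENNReal_le.2 h1
    _ = ENNReal.ofReal ((max 1 ⌈L⌉₊ : ℕ) : ℝ) := by
      rw [ENNReal.ofReal_natCast, ENat.toENNReal_coe]
    _ ≤ _ := ENNReal.ofReal_le_ofReal h2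

end Contrastive

theorem theorem5 :
    ∃ K : ℝ, 0 < K ∧
      ∀ (k : ℕ) (f : ℝ≥0 → ℝ≥0),
        (∀ x, f x ≤ x ^ 2) →
        Monotone (fun x : ℝ≥0 => f x / x) →
        Function.Injective (fun x : ℝ≥0 => f x / x) →
        ∀ ε δ : ℝ, 0 < ε → ε ≤ 1 → 0 < δ → δ ≤ 1 →
          -- `r` is the value of the inverse of `x ↦ f x / x` at `π ε`
          ∀ r : ℝ≥0, ((f r / r : ℝ≥0) : ℝ) = Real.pi * ε →
            ((Contrastive.passiveSampleComplexity (Contrastive.halfBall k) (Contrastive.HHS k)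
                (Contrastive.approxCE (Contrastive.halfBall k) f) ε δ : ℕ∞) : ℝ≥0∞)
              ≤ ENNReal.ofReal (max 1 (K * (Real.log (1 / δ) / r))) ∧
            ∀ A : Contrastive.PassiveLearner (Contrastive.HHS k), Contrastive.UsesClosestPair A →
              ((Contrastive.learnerSampleComplexity (Contrastive.halfBall k)
                  (Contrastive.approxCE (Contrastive.halfBall k) f) A ε δ : ℕ∞) : ℝ≥0∞)
                ≤ ENNReal.ofReal (max 1 (K * (Real.log (1 / δ) / r))) := by
  refine ⟨3 / 2, by norm_num, fun k f hf hmono hinj ε δ hε _ hδ _ r hr => ?_⟩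
  have h := fun (A : Contrastive.PassiveLearner (Contrastive.HHS k))
      (hA : Contrastive.UsesClosestPair A) =>
    Contrastive.learnerSampleComplexity_le_ofReal hf (hmono.strictMono_of_injective hinj) hε hδ hr
      hA
  obtain ⟨A, hA⟩ := Contrastive.exists_usesClosestPair k
  exact ⟨(ENat.toENNReal_le.2 (iInf_le _ A)).trans (h A hA), h⟩
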